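/- Let $n$ be a non-negative integer and let $M_n$ be the space of $n\times n$ complex matrices. For $X\in M_n$ let $\sigma_1(X)\ge\sigma_2(X)\ge\dots\ge\sigma_n(X)\ge 0$ be the singular values of $X$, that is, the square roots of the eigenvalues of $X^*X$ counted with multiplicity. Call $X$ a strict contraction if its spectral norm satisfies $\|X\|<1$, and, when $X+iI$ is invertible, let $\mathcal C(X)=(X-iI)(X+iI)^{-1}$ be its Cayley transform. Theorem 4.1. Let $A,B\in M_n$ be strict contractions. Then $A+iI$ and $B+iI$ are invertible, so that $\mathcal C(A)$ and $\mathcal C(B)$ are well defined, and for all indices $1\le i_1<\dots<i_k\le n$, $$\prod_{j=1}^k\frac{1-\sigma_{n-i_j+1}(A)}{1+\sigma_j(A)}\;\le\;\prod_{j=1}^k\sigma_{i_j}\big(\mathcal C(A)\big)\;\le\;\prod_{j=1}^k\frac{1+\sigma_{i_j}(A)}{1-\sigma_j(A)}$$ and $$\prod_{j=1}^k\frac{2\,\sigma_{i_j}(A-B)}{(1+\sigma_j(A))(1+\sigma_j(B))}\;\le\;\prod_{j=1}^k\sigma_{i_j}\big(\mathcal C(A)-\mathcal C(B)\big)\;\le\;\prod_{j=1}^k\frac{2\,\sigma_{i_j}(A-B)}{(1-\sigma_j(A))(1-\sigma_j(B))}.$$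 -/

import Mathlib

/-- The space `M_n` of `n × n` complex matrices. -/
abbrev CMat (n : ℕ) : Type := Matrix (Fin n) (Fin n) ℂ

/-- The singular values of `X` in non-increasing order, counted with multiplicity: the square roots
of the eigenvalues of `X* X` for the Euclidean inner product on `ℂⁿ`.
The index starts at `0`, so `singVal X 0` is the largest and `singVal X (n - 1)` the smallest one. -/
noncomputable def singVal {n : ℕ} (X : CMat n) (j : ℕ) : ℝ :=
  (Matrix.toEuclideanLin X).singularValues j

/-- `X` is a strict contraction: its spectral norm (the operator norm for the Euclidean norm on
`ℂⁿ`) is less than `1`. -/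
def IsStrictContraction {n : ℕ} (X : CMat n) : Prop :=
  ‖Matrix.toEuclideanCLM (n := Fin n) (𝕜 := ℂ) X‖ < 1

/-- The Cayley transform `(X - iI)(X + iI)⁻¹`; it is meaningful when `X + iI` is invertible. -/
noncomputable def cayley {n : ℕ} (X : CMat n) : CMat n :=
  (X - Complex.I • (1 : CMat n)) * (X + Complex.I • (1 : CMat n))⁻¹

open Module InnerProductSpace

/-! The engine is the Gelfand–Naimark inequality ∏ σ_{i_j}(YX) ≤ ∏ σ_{i_j}(X) σ_j(Y), together with
its mirror image for XY. It comes from a determinant: all singular values of ZX multiply to |det Z|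
|det X|, so a lower bound on those outside the chosen indices is an upper bound on the chosen ones
(`prod_singularValues_comp_le_of_injective`).

The upper bounds apply it to C(A) = (A - iI)(A + iI)⁻¹ and C(A) - C(B) = 2i (A + iI)⁻¹(A - B)(B +
iI)⁻¹; the lower bounds apply it to the same identities with the inverses cleared. The factors A ±
iI and (A + iI)⁻¹ are controlled by min-max: on a subspace where ‖Ax‖ ≤ c‖x‖, the vector Ax ± ix has
norm between (1 - c)‖x‖ and (1 + c)‖x‖. -/

theorem OrthonormalBasis.exists_subspace_repr_eq_zero {𝕜 E ι : Type*} [RCLike 𝕜] [NormedAddCommGroup E]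
    [InnerProductSpace 𝕜 E] [Fintype ι]
    (b : OrthonormalBasis ι 𝕜 E) (s : Finset ι) :
    ∃ W : Submodule 𝕜 E, finrank 𝕜 W = s.card ∧ ∀ x ∈ W, ∀ i ∉ s, b.repr x i = 0 := by
  refine ⟨Submodule.span 𝕜 (Set.range fun i : s => b i), ?_, ?_⟩
  · exact (finrank_span_eq_card (b.orthonormal.linearIndependent.comp (fun i : s => (i : ι))
      Subtype.val_injective)).trans (by simp)
  · intro x hx i hi
    induction hx using Submodule.span_induction with
    | mem x h =>
      obtain ⟨⟨j, hj⟩, rfl⟩ := h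
      classical
      have : i ≠ j := by rintro rfl; exact hi hj
      simp [b.repr_self, this]
    | zero => simp
    | add x y _ _ hx hy => simp [hx, hy]
    | smul a x _ hx => simp [hx]

namespace LinearMap

/-! ### Min-max estimates for singular values -/

section MinMax

variable {𝕜 : Type*} [RCLike 𝕜]
  {E : Type*} [NormedAddCommGroup E] [InnerProductSpace 𝕜 E] [FiniteDimensional 𝕜 E]
  {F : Type*} [NormedAddCommGroup F] [InnerProductSpace 𝕜 F] [FiniteDimensional 𝕜 F]

/-- An orthonormal basis of right singular vectors. -/
noncomputable def rightSingularBasis (T : E →ₗ[𝕜] F) :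
    OrthonormalBasis (Fin (finrank 𝕜 E)) 𝕜 E :=
  T.isSymmetric_adjoint_comp_self.eigenvectorBasis rfl

theorem norm_sq_apply_eq_sum (T : E →ₗ[𝕜] F) (x : E) :
    ‖T x‖ ^ 2 =
      ∑ i : Fin (finrank 𝕜 E), (T.singularValues i * ‖T.rightSingularBasis.repr x i‖) ^ 2 := by
  have h1 : ((‖T x‖ ^ 2 : ℝ) : 𝕜) = ⟪x, (adjoint T ∘ₗ T) x⟫_𝕜 := by
    rw [comp_apply, adjoint_inner_right, inner_self_eq_norm_sq_to_K]; push_cast; rfl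
  rw [← T.rightSingularBasis.sum_inner_mul_inner] at h1
  apply RCLike.ofReal_injective (K := 𝕜)
  rw [h1, RCLike.ofReal_sum]
  refine Finset.sum_congr rfl fun i _ => ?_
  rw [← OrthonormalBasis.repr_apply_apply, rightSingularBasis,
    T.isSymmetric_adjoint_comp_self.eigenvectorBasis_apply_self_apply rfl,
    ← sq_singularValues_fin, ← inner_conj_symm, ← OrthonormalBasis.repr_apply_apply, mul_left_comm,
    RCLike.conj_mul, mul_pow]
  push_cast
  rfl

/-- `T` is bounded by its `j`-th singular value on a subspace of codimension at most `j`. -/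
theorem exists_subspace_norm_le (T : E →ₗ[𝕜] F) (j : ℕ) :
    ∃ W : Submodule 𝕜 E, finrank 𝕜 E ≤ finrank 𝕜 W + j ∧
      ∀ x ∈ W, ‖T x‖ ≤ T.singularValues j * ‖x‖ := by
  obtain ⟨W, hW, h⟩ := T.rightSingularBasis.exists_subspace_repr_eq_zero
    (Finset.univ.filter fun i => j ≤ (i : ℕ))
  refine ⟨W, ?_, fun x hx => ?_⟩
  · have h1 := Finset.card_filter_add_card_filter_not (s := (Finset.univ : Finset (Fin (finrank 𝕜 E))))
      (fun i => j ≤ (i : ℕ))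
    have h2 : (Finset.univ.filter fun i : Fin (finrank 𝕜 E) => ¬ j ≤ (i : ℕ)).card ≤ j := by
      have := Finset.card_le_card_of_injOn (t := Finset.range j) (fun i : Fin (finrank 𝕜 E) => (i : ℕ))
        (s := Finset.univ.filter fun i : Fin (finrank 𝕜 E) => ¬ j ≤ (i : ℕ))
        (by intro i hi; simpa using hi) (Fin.val_injective.injOn)
      simpa using this
    simp only [Finset.card_univ, Fintype.card_fin] at h1
    omega
  · refine (sq_le_sq₀ (norm_nonneg _)
      (mul_nonneg (T.singularValues_nonneg j) (norm_nonneg x))).mp ?_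
    rw [norm_sq_apply_eq_sum, mul_pow, ← T.rightSingularBasis.repr.norm_map x,
      EuclideanSpace.norm_sq_eq, Finset.mul_sum]
    refine Finset.sum_le_sum fun i _ => ?_
    rw [mul_pow]
    by_cases hi : j ≤ (i : ℕ)
    · gcongr
      · exact T.singularValues_nonneg i
      · exact T.singularValues_antitone hi
    · rw [h x hx i (by simpa using hi)]
      simp

/-- `T` is bounded below by its `j`-th singular value on a subspace of dimension `j + 1`. -/
theorem exists_subspace_le_norm (T : E →ₗ[𝕜] F) {j : ℕ} (hj : j < finrank 𝕜 E) :
    ∃ W : Submodule 𝕜 E, finrank 𝕜 W = j + 1 ∧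
      ∀ x ∈ W, T.singularValues j * ‖x‖ ≤ ‖T x‖ := by
  obtain ⟨W, hW, h⟩ := T.rightSingularBasis.exists_subspace_repr_eq_zero
    (Finset.Iic ⟨j, hj⟩)
  refine ⟨W, by simpa using hW, fun x hx => ?_⟩
  refine (sq_le_sq₀ (mul_nonneg (T.singularValues_nonneg j) (norm_nonneg x))
    (norm_nonneg _)).mp ?_
  rw [norm_sq_apply_eq_sum, mul_pow, ← T.rightSingularBasis.repr.norm_map x,
    EuclideanSpace.norm_sq_eq, Finset.mul_sum]
  refine Finset.sum_le_sum fun i _ => ?_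
  rw [mul_pow]
  by_cases hi : i ∈ Finset.Iic (⟨j, hj⟩ : Fin (finrank 𝕜 E))
  · gcongr
    · exact T.singularValues_nonneg j
    · exact T.singularValues_antitone (by simpa [Fin.le_def] using hi)
  · rw [h x hx i hi]
    simp

theorem _root_.Submodule.exists_mem_inf_ne_zero (V W : Submodule 𝕜 E)
    (h : finrank 𝕜 E < finrank 𝕜 V + finrank 𝕜 W) : ∃ x ∈ V, x ∈ W ∧ x ≠ 0 := by
  have h1 := Submodule.finrank_sup_add_finrank_inf_eq V W
  have h2 := Submodule.finrank_le (V ⊔ W)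
  have h3 : V ⊓ W ≠ ⊥ := by
    intro h0
    rw [h0, finrank_bot] at h1
    omega
  obtain ⟨x, hx, hx0⟩ := Submodule.exists_mem_ne_zero_of_ne_bot h3
  exact ⟨x, hx.1, hx.2, hx0⟩

/-- By dimension count, `W` meets the (j + 1)-dimensional space on which `T` is bounded below by its
`j`-th singular value. -/
theorem singularValues_le_of_subspace (T : E →ₗ[𝕜] F) {j : ℕ} {c : ℝ} (hc : 0 ≤ c)
    (W : Submodule 𝕜 E) (hW : finrank 𝕜 E ≤ finrank 𝕜 W + j)
    (h : ∀ x ∈ W, ‖T x‖ ≤ c * ‖x‖) : T.singularValues j ≤ c := by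
  by_cases hj : j < finrank 𝕜 E
  · obtain ⟨V, hV, hV'⟩ := T.exists_subspace_le_norm hj
    obtain ⟨x, hxV, hxW, hx⟩ := V.exists_mem_inf_ne_zero W (by omega)
    exact le_of_mul_le_mul_right ((hV' x hxV).trans (h x hxW)) (norm_pos_iff.mpr hx)
  -- Beyond the dimension singular values are 0 by convention, so only `hc` is needed.
  · rwa [T.singularValues_of_finrank_le (not_lt.mp hj)]

theorem le_singularValues_of_subspace (T : E →ₗ[𝕜] F) {j : ℕ} {c : ℝ}
    (W : Submodule 𝕜 E) (hW : j < finrank 𝕜 W)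
    (h : ∀ x ∈ W, c * ‖x‖ ≤ ‖T x‖) : c ≤ T.singularValues j := by
  obtain ⟨V, hV, hV'⟩ := T.exists_subspace_norm_le j
  obtain ⟨x, hxV, hxW, hx⟩ := V.exists_mem_inf_ne_zero W (by omega)
  exact le_of_mul_le_mul_right ((h x hxW).trans (hV' x hxV)) (norm_pos_iff.mpr hx)

variable {G : Type*} [NormedAddCommGroup G] [InnerProductSpace 𝕜 G] [FiniteDimensional 𝕜 G]

theorem singularValues_le_mul_of_norm_le (S : E →ₗ[𝕜] F) (T : E →ₗ[𝕜] G) {c : ℝ} (hc : 0 ≤ c)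
    (h : ∀ x, ‖S x‖ ≤ c * ‖T x‖) (j : ℕ) : S.singularValues j ≤ c * T.singularValues j := by
  obtain ⟨W, hW, hT⟩ := T.exists_subspace_norm_le j
  refine S.singularValues_le_of_subspace (mul_nonneg hc (T.singularValues_nonneg j)) W hW
    fun x hx => (h x).trans ?_
  rw [mul_assoc]
  exact mul_le_mul_of_nonneg_left (hT x hx) hc

theorem singularValues_le_add_of_norm_sub_le (S T : E →ₗ[𝕜] F) {c : ℝ} (hc : 0 ≤ c)
    (h : ∀ x, ‖S x - T x‖ ≤ c * ‖x‖) (j : ℕ) : S.singularValues j ≤ T.singularValues j + c := by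
  obtain ⟨W, hW, hT⟩ := T.exists_subspace_norm_le j
  refine S.singularValues_le_of_subspace (add_nonneg (T.singularValues_nonneg j) hc) W hW
    fun x hx => ?_
  have h1 : ‖S x‖ ≤ ‖T x‖ + ‖S x - T x‖ := by
    simpa using norm_add_le (T x) (S x - T x)
  linarith [h x, hT x hx]

/-- T*T and TT* have the same characteristic polynomial. -/
theorem singularValues_adjoint (T : E →ₗ[𝕜] E) :
    (adjoint T).singularValues = T.singularValues := by
  ext j
  by_cases hj : j < finrank 𝕜 E
  · rw [singularValues_of_lt _ rfl hj, singularValues_of_lt _ rfl hj]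
    refine congrArg Real.sqrt (congrFun ((IsSymmetric.eigenvalues_eq_eigenvalues_iff
      _ _ _ _).mpr ?_) _)
    rw [adjoint_adjoint]
    let b := (stdOrthonormalBasis 𝕜 E).toBasis
    rw [← charpoly_toMatrix _ b, ← charpoly_toMatrix _ b, toMatrix_comp b b b, toMatrix_comp b b b,
      Matrix.charpoly_mul_comm]
  · rw [singularValues_of_finrank_le _ (not_lt.mp hj), singularValues_of_finrank_le _ (not_lt.mp hj)]

theorem prod_singularValues_eq_norm_det (T : E →ₗ[𝕜] E) :
    ∏ i : Fin (finrank 𝕜 E), T.singularValues i = ‖LinearMap.det T‖ := by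
  rw [← normDet_eq_norm_det, normDet_eq_prod_singularValues]
  simp [Finset.prod_range]

/-! ### The Gelfand–Naimark inequality -/

/-- Raising the small singular values of `Y` to `c` yields a map that dominates `Y`. -/
theorem exists_norm_le_and_mul_norm_le (Y : E →ₗ[𝕜] E) {c : ℝ} (hc : 0 ≤ c) :
    ∃ Z : E →ₗ[𝕜] E, (∀ x, ‖Y x‖ ≤ ‖Z x‖) ∧ (∀ x, c * ‖x‖ ≤ ‖Z x‖) ∧
      ‖LinearMap.det Z‖ = ∏ i : Fin (finrank 𝕜 E), max (Y.singularValues i) c := by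
  let b := Y.rightSingularBasis
  let m : Fin (finrank 𝕜 E) → ℝ := fun i => max (Y.singularValues i) c
  have hm : ∀ i, 0 ≤ m i := fun i => hc.trans (le_max_right _ _)
  -- `Z` is diagonal in the right singular basis of `Y`, so both norms are weighted sums over the
  -- same coordinates.
  let Z : E →ₗ[𝕜] E := Matrix.toLin b.toBasis b.toBasis (Matrix.diagonal fun i => (m i : 𝕜))
  have hZ : ∀ x i, b.repr (Z x) i = (m i : 𝕜) * b.repr x i := by
    intro x i
    have h := congrFun (LinearMap.toMatrix_mulVec_repr b.toBasis b.toBasis Z x) i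
    rw [LinearMap.toMatrix_toLin, Matrix.mulVec_diagonal] at h
    simpa using h.symm
  have hn : ∀ x, ‖Z x‖ ^ 2 = ∑ i, (m i * ‖b.repr x i‖) ^ 2 := by
    intro x
    rw [← b.repr.norm_map (Z x), EuclideanSpace.norm_sq_eq]
    refine Finset.sum_congr rfl fun i _ => ?_
    rw [hZ, norm_mul, RCLike.norm_ofReal, abs_of_nonneg (hm i)]
  refine ⟨Z, fun x => ?_, fun x => ?_, ?_⟩
  · refine (sq_le_sq₀ (norm_nonneg _) (norm_nonneg _)).mp ?_
    rw [hn, norm_sq_apply_eq_sum]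
    refine Finset.sum_le_sum fun i _ => ?_
    have := Y.singularValues_nonneg i
    gcongr
    exact le_max_left _ _
  · refine (sq_le_sq₀ (mul_nonneg hc (norm_nonneg _)) (norm_nonneg _)).mp ?_
    rw [hn, mul_pow, ← b.repr.norm_map x, EuclideanSpace.norm_sq_eq, Finset.mul_sum]
    refine Finset.sum_le_sum fun i _ => ?_
    rw [mul_pow]
    gcongr
    exact le_max_right _ _
  · rw [LinearMap.det_toLin, Matrix.det_diagonal, norm_prod]
    refine Finset.prod_congr rfl fun i _ => ?_
    rw [RCLike.norm_ofReal, abs_of_nonneg (hm i)]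

theorem prod_max_singularValues (Y : E →ₗ[𝕜] E) {k : ℕ} (hk : k < finrank 𝕜 E) :
    ∏ i : Fin (finrank 𝕜 E), max (Y.singularValues i) (Y.singularValues k) =
      (∏ j : Fin (k + 1), Y.singularValues j) *
        Y.singularValues k ^ (finrank 𝕜 E - (k + 1)) := by
  rw [Fin.prod_univ_eq_prod_range (fun i => max (Y.singularValues i) (Y.singularValues k)),
    Fin.prod_univ_eq_prod_range (fun i => Y.singularValues i),
    ← Finset.prod_range_mul_prod_Ico _ (Nat.succ_le_of_lt hk)]
  congr 1
  · refine Finset.prod_congr rfl fun i hi => max_eq_left (Y.singularValues_antitone ?_)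
    simp at hi; omega
  · rw [Finset.prod_congr rfl (g := fun _ => Y.singularValues k)]
    · simp
    · intro i hi
      simp only [Finset.mem_Ico] at hi
      exact max_eq_right (Y.singularValues_antitone (by omega))

/-- Replace `Y` by the dominating `Z` with all singular values at least `c`. Each singular value of
ZX outside the chosen indices is at least `c` times that of `X`; dividing det(ZX) by these leaves
exactly the claimed bound. Injectivity makes the divisor positive. -/
theorem prod_singularValues_comp_le_of_injective {X Y : E →ₗ[𝕜] E} (hX : Function.Injective X)
    (hY : Function.Injective Y) {k : ℕ} (i : Fin k → Fin (finrank 𝕜 E))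
    (hi : Function.Injective i) :
    ∏ j : Fin k, (Y ∘ₗ X).singularValues (i j) ≤
      ∏ j : Fin k, X.singularValues (i j) * Y.singularValues j := by
  obtain _ | k := k
  · simp
  -- There are now k + 1 indices, so `c` below is the smallest singular value of `Y` on the
  -- right-hand side.
  have hk : k < finrank 𝕜 E := by simpa using Fintype.card_le_of_injective i hi
  set c := Y.singularValues k with hc
  have hc0 : 0 < c := Y.injective_iff_forall_lt_finrank_singularValues_pos.mp hY k hk
  have hX0 : ∀ l : Fin (finrank 𝕜 E), 0 < X.singularValues l := fun l =>
    X.injective_iff_forall_lt_finrank_singularValues_pos.mp hX l l.2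
  obtain ⟨Z, hZ1, hZ2, hZ3⟩ := Y.exists_norm_le_and_mul_norm_le hc0.le
  rw [hc, prod_max_singularValues Y hk, ← hc] at hZ3
  have h1 : ∀ l : ℕ, (Y ∘ₗ X).singularValues l ≤ (Z ∘ₗ X).singularValues l := fun l => by
    simpa using singularValues_le_mul_of_norm_le (Y ∘ₗ X) (Z ∘ₗ X) zero_le_one
      (fun x => by simpa using hZ1 (X x)) l
  have h2 : ∀ l : ℕ, c * X.singularValues l ≤ (Z ∘ₗ X).singularValues l := fun l => by
    have := singularValues_le_mul_of_norm_le X (Z ∘ₗ X) (inv_nonneg.mpr hc0.le)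
      (fun x => by rw [le_inv_mul_iff₀ hc0]; exact hZ2 (X x)) l
    rwa [le_inv_mul_iff₀ hc0] at this
  have h3 := prod_singularValues_eq_norm_det (Z ∘ₗ X)
  rw [LinearMap.det_comp, norm_mul, hZ3, ← prod_singularValues_eq_norm_det X] at h3
  set s : Finset (Fin (finrank 𝕜 E)) := Finset.univ.map ⟨i, hi⟩ with hs
  have hcard : sᶜ.card = finrank 𝕜 E - (k + 1) := by
    rw [Finset.card_compl]; simp [hs]
  rw [← Finset.prod_mul_prod_compl s, ← Finset.prod_mul_prod_compl s] at h3
  have h4 : c ^ (finrank 𝕜 E - (k + 1)) * ∏ l ∈ sᶜ, X.singularValues l ≤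
      ∏ l ∈ sᶜ, (Z ∘ₗ X).singularValues l := by
    rw [← hcard, ← Finset.prod_const, ← Finset.prod_mul_distrib]
    exact Finset.prod_le_prod (fun l _ => mul_nonneg hc0.le (hX0 l).le) fun l _ => h2 l
  have h5 : 0 < c ^ (finrank 𝕜 E - (k + 1)) * ∏ l ∈ sᶜ, X.singularValues l :=
    mul_pos (pow_pos hc0 _) (Finset.prod_pos fun l _ => hX0 l)
  have h6 : ∏ l ∈ s, (Z ∘ₗ X).singularValues l ≤
      (∏ l ∈ s, X.singularValues l) * ∏ j : Fin (k + 1), Y.singularValues j := by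
    refine le_of_mul_le_mul_right ?_ h5
    refine (mul_le_mul_of_nonneg_left h4
      (Finset.prod_nonneg fun l _ => singularValues_nonneg _ _)).trans (le_of_eq ?_)
    rw [h3]
    ring
  rw [Finset.prod_mul_distrib]
  simp only [hs, Finset.prod_map, Function.Embedding.coeFn_mk] at h6
  exact (Finset.prod_le_prod (fun _ _ => singularValues_nonneg _ _) fun _ _ => h1 _).trans h6

theorem tendsto_singularValues_add_smul (S T : E →ₗ[𝕜] F) (j : ℕ) :
    Filter.Tendsto (fun ε : ℝ => (S + (ε : 𝕜) • T).singularValues j) (nhds 0)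
      (nhds (S.singularValues j)) := by
  have hT : ∀ (ε : ℝ) (x : E), ‖(ε : 𝕜) • T x‖ ≤ |ε| * ‖T.toContinuousLinearMap‖ * ‖x‖ := by
    intro ε x
    rw [norm_smul, RCLike.norm_ofReal, mul_assoc]
    exact mul_le_mul_of_nonneg_left (T.toContinuousLinearMap.le_opNorm x) (abs_nonneg ε)
  have h0 : ∀ ε : ℝ, 0 ≤ |ε| * ‖T.toContinuousLinearMap‖ := fun ε => by positivity
  rw [tendsto_iff_dist_tendsto_zero]
  refine squeeze_zero (g := fun ε : ℝ => |ε| * ‖T.toContinuousLinearMap‖)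
    (fun _ => dist_nonneg) (fun ε => ?_) ?_
  · rw [Real.dist_eq, abs_sub_le_iff]
    constructor
    · have := singularValues_le_add_of_norm_sub_le (S + (ε : 𝕜) • T) S (h0 ε)
        (fun x => by simpa using hT ε x) j
      linarith
    · have := singularValues_le_add_of_norm_sub_le S (S + (ε : 𝕜) • T) (h0 ε)
        (fun x => by simpa using hT ε x) j
      linarith
  · have : Continuous fun ε : ℝ => |ε| * ‖T.toContinuousLinearMap‖ := by fun_prop
    simpa using this.tendsto 0

/-- Injectivity fails only when -ε is one of the finitely many eigenvalues of `X`. -/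
theorem eventually_injective_add_smul_id (X : E →ₗ[𝕜] E) :
    ∀ᶠ ε : ℝ in nhdsWithin 0 {0}ᶜ, Function.Injective (X + (ε : 𝕜) • (LinearMap.id : E →ₗ[𝕜] E)) := by
  have hfin : {ε : ℝ | End.HasEigenvalue X (-(ε : 𝕜))}.Finite :=
    (End.finite_hasEigenvalue X).preimage
      (fun a _ b _ h => RCLike.ofReal_injective (K := 𝕜) (neg_injective h))
  filter_upwards [nhdsNE_le_cofinite 0 hfin.compl_mem_cofinite] with ε hε
  rw [injective_iff_map_eq_zero]
  intro x hx
  by_contra hx0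
  refine hε (End.hasEigenvalue_of_hasEigenvector (x := x) ⟨End.mem_eigenspace_iff.mpr ?_, hx0⟩)
  rw [neg_smul]
  exact eq_neg_of_add_eq_zero_left hx

/-- The **Gelfand–Naimark** inequality for singular values of a product. -/
theorem prod_singularValues_comp_le {X Y : E →ₗ[𝕜] E}
    (hY : Function.Injective Y) {k : ℕ} (i : Fin k → Fin (finrank 𝕜 E))
    (hi : Function.Injective i) :
    ∏ j : Fin k, (Y ∘ₗ X).singularValues (i j) ≤
      ∏ j : Fin k, X.singularValues (i j) * Y.singularValues j := by
  -- Perturb `X` to the injective X + εI, for which YX becomes YX + εY, and let ε → 0.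
  have h1 : Filter.Tendsto (fun ε : ℝ => ∏ j : Fin k, (Y ∘ₗ X + (ε : 𝕜) • Y).singularValues (i j))
      (nhdsWithin 0 {0}ᶜ) (nhds (∏ j : Fin k, (Y ∘ₗ X).singularValues (i j))) :=
    tendsto_finsetProd _ fun j _ =>
      (tendsto_singularValues_add_smul _ _ _).mono_left nhdsWithin_le_nhds
  have h2 : Filter.Tendsto (fun ε : ℝ => ∏ j : Fin k,
        (X + (ε : 𝕜) • LinearMap.id).singularValues (i j) * Y.singularValues j)
      (nhdsWithin 0 {0}ᶜ) (nhds (∏ j : Fin k, X.singularValues (i j) * Y.singularValues j)) :=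
    tendsto_finsetProd _ fun j _ =>
      ((tendsto_singularValues_add_smul _ _ _).mono_left nhdsWithin_le_nhds).mul_const _
  refine le_of_tendsto_of_tendsto h1 h2 ?_
  filter_upwards [X.eventually_injective_add_smul_id] with ε hε
  have := prod_singularValues_comp_le_of_injective hε hY i hi
  rwa [LinearMap.comp_add, LinearMap.comp_smul, LinearMap.comp_id] at this

/-- The **Gelfand–Naimark** inequality, with the factors exchanged. -/
theorem prod_singularValues_comp_le' {X Y : E →ₗ[𝕜] E}
    (hY : Function.Injective Y) {k : ℕ} (i : Fin k → Fin (finrank 𝕜 E))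
    (hi : Function.Injective i) :
    ∏ j : Fin k, (X ∘ₗ Y).singularValues (i j) ≤
      ∏ j : Fin k, X.singularValues (i j) * Y.singularValues j := by
  have hY' : Function.Injective (adjoint Y) := by
    rw [injective_iff_forall_lt_finrank_singularValues_pos, singularValues_adjoint,
      ← injective_iff_forall_lt_finrank_singularValues_pos]
    exact hY
  have := prod_singularValues_comp_le (X := adjoint X) hY' i hi
  rwa [← adjoint_comp, singularValues_adjoint, singularValues_adjoint, singularValues_adjoint]
    at this

end MinMax

end LinearMap

/-! ### Transfer to matrices and bounds for X + zI with |z| = 1 -/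

section Matrix

variable {n : ℕ}

theorem singVal_nonneg (X : CMat n) (j : ℕ) : 0 ≤ singVal X j :=
  LinearMap.singularValues_nonneg _ _

theorem toEuclideanLin_injective_of_isUnit {Y : CMat n} (hY : IsUnit Y) :
    Function.Injective (Matrix.toEuclideanLin Y) := by
  intro x y h
  apply WithLp.ofLp_injective
  apply Matrix.mulVec_injective_iff_isUnit.mpr hY
  simpa [Matrix.toLpLin_apply] using h

theorem isUnit_of_toEuclideanLin_injective {Y : CMat n}
    (hY : Function.Injective (Matrix.toEuclideanLin Y)) : IsUnit Y := by
  rw [← Matrix.mulVec_injective_iff_isUnit]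
  intro x y h
  have := @hY (WithLp.toLp 2 x) (WithLp.toLp 2 y) (by simpa [Matrix.toLpLin_apply] using h)
  simpa using this

theorem toEuclideanLin_mul (X Y : CMat n) :
    Matrix.toEuclideanLin (X * Y) = Matrix.toEuclideanLin X ∘ₗ Matrix.toEuclideanLin Y :=
  Matrix.toLpLin_mul_same ..

theorem prod_singVal_mul_le {X Y : CMat n} (hY : IsUnit Y) {k : ℕ} {i : Fin k → Fin n}
    (hi : Function.Injective i) :
    ∏ j : Fin k, singVal (Y * X) (i j) ≤ ∏ j : Fin k, singVal X (i j) * singVal Y j := by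
  have hn : n = finrank ℂ (EuclideanSpace ℂ (Fin n)) := by simp
  have := LinearMap.prod_singularValues_comp_le (X := Matrix.toEuclideanLin X)
    (toEuclideanLin_injective_of_isUnit hY) (Fin.cast hn ∘ i) ((Fin.cast_injective hn).comp hi)
  rw [← toEuclideanLin_mul] at this
  exact this

theorem prod_singVal_mul_le' {X Y : CMat n} (hY : IsUnit Y) {k : ℕ} {i : Fin k → Fin n}
    (hi : Function.Injective i) :
    ∏ j : Fin k, singVal (X * Y) (i j) ≤ ∏ j : Fin k, singVal X (i j) * singVal Y j := by
  have hn : n = finrank ℂ (EuclideanSpace ℂ (Fin n)) := by simp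
  have := LinearMap.prod_singularValues_comp_le' (X := Matrix.toEuclideanLin X)
    (toEuclideanLin_injective_of_isUnit hY) (Fin.cast hn ∘ i) ((Fin.cast_injective hn).comp hi)
  rw [← toEuclideanLin_mul] at this
  exact this

theorem prod_singVal_mul_mul_le {X Y Z : CMat n} (hY : IsUnit Y) (hZ : IsUnit Z) {k : ℕ}
    {i : Fin k → Fin n} (hi : Function.Injective i) :
    ∏ j : Fin k, singVal (Y * X * Z) (i j) ≤
      ∏ j : Fin k, singVal X (i j) * (singVal Y j * singVal Z j) := by
  refine (prod_singVal_mul_le' hZ hi).trans ?_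
  rw [Finset.prod_mul_distrib]
  refine (mul_le_mul_of_nonneg_right (prod_singVal_mul_le hY hi)
    (Finset.prod_nonneg fun _ _ => singVal_nonneg _ _)).trans_eq ?_
  rw [← Finset.prod_mul_distrib]
  exact Finset.prod_congr rfl fun _ _ => by ring

theorem singVal_smul_le (z : ℂ) (X : CMat n) (j : ℕ) :
    singVal (z • X) j ≤ ‖z‖ * singVal X j :=
  LinearMap.singularValues_le_mul_of_norm_le _ _ (norm_nonneg z)
    (fun x => by rw [map_smul, LinearMap.smul_apply, norm_smul]) j

theorem singVal_lt_one {X : CMat n} (hX : IsStrictContraction X) (j : ℕ) : singVal X j < 1 := by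
  refine lt_of_le_of_lt ?_ hX
  refine LinearMap.singularValues_le_of_subspace _ (norm_nonneg _) ⊤ (by simp) fun x _ => ?_
  exact (Matrix.toEuclideanCLM (n := Fin n) (𝕜 := ℂ) X).le_opNorm x

theorem toEuclideanLin_add_smul_one_apply (X : CMat n) (z : ℂ) (x : EuclideanSpace ℂ (Fin n)) :
    Matrix.toEuclideanLin (X + z • (1 : CMat n)) x = Matrix.toEuclideanLin X x + z • x := by
  simp

theorem singVal_add_smul_one_le (X : CMat n) {z : ℂ} (hz : ‖z‖ = 1) (j : ℕ) :
    singVal (X + z • (1 : CMat n)) j ≤ 1 + singVal X j := by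
  rw [add_comm 1]
  refine LinearMap.singularValues_le_add_of_norm_sub_le (Matrix.toEuclideanLin (X + z • (1 : CMat n)))
    (Matrix.toEuclideanLin X) zero_le_one (fun x => ?_) j
  rw [toEuclideanLin_add_smul_one_apply, add_sub_cancel_left, norm_smul, hz]

theorem one_sub_mul_norm_le {X : CMat n} {z : ℂ} (hz : ‖z‖ = 1) {c : ℝ}
    {x : EuclideanSpace ℂ (Fin n)} (h : ‖Matrix.toEuclideanLin X x‖ ≤ c * ‖x‖) :
    (1 - c) * ‖x‖ ≤ ‖Matrix.toEuclideanLin (X + z • (1 : CMat n)) x‖ := by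
  rw [toEuclideanLin_add_smul_one_apply]
  have h1 : ‖z • x‖ = ‖x‖ := by rw [norm_smul, hz, one_mul]
  have h2 := norm_sub_norm_le (z • x) (-Matrix.toEuclideanLin X x)
  rw [norm_neg, sub_neg_eq_add, add_comm (z • x), h1] at h2
  linarith

theorem one_sub_singVal_rev_le (X : CMat n) {z : ℂ} (hz : ‖z‖ = 1) (i : Fin n) :
    1 - singVal X i.rev ≤ singVal (X + z • (1 : CMat n)) i := by
  obtain ⟨W, hW, h⟩ := (Matrix.toEuclideanLin X).exists_subspace_norm_le i.rev
  refine LinearMap.le_singularValues_of_subspace _ W ?_ fun x hx => one_sub_mul_norm_le hz (h x hx)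
  -- `i.rev` is n - 1 - i, so `W` has dimension at least i + 1.
  rw [finrank_euclideanSpace_fin, Fin.val_rev] at hW
  omega

theorem isUnit_add_smul_one {X : CMat n} (hX : IsStrictContraction X) {z : ℂ} (hz : ‖z‖ = 1) :
    IsUnit (X + z • (1 : CMat n)) := by
  apply isUnit_of_toEuclideanLin_injective
  rw [injective_iff_map_eq_zero]
  intro x hx
  have h := one_sub_mul_norm_le (X := X) hz
    ((Matrix.toEuclideanCLM (n := Fin n) (𝕜 := ℂ) X).le_opNorm x)
  rw [hx, norm_zero] at h
  have h1 : 0 < 1 - ‖Matrix.toEuclideanCLM (n := Fin n) (𝕜 := ℂ) X‖ := sub_pos.mpr hX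
  by_contra hx0
  exact absurd h (not_le.mpr (mul_pos h1 (norm_pos_iff.mpr hx0)))

/-- The test space is the image under X + zI of a space of codimension at most `j` where ‖Xx‖ ≤
σ‖x‖; there the inverse expands by at most 1/(1 - σ). -/
theorem singVal_inv_add_smul_one_le {X : CMat n} (hX : IsStrictContraction X) {z : ℂ}
    (hz : ‖z‖ = 1) (j : ℕ) :
    singVal (X + z • (1 : CMat n))⁻¹ j ≤ (1 - singVal X j)⁻¹ := by
  have hu := isUnit_add_smul_one hX hz
  have h0 : 0 < 1 - singVal X j := sub_pos.mpr (singVal_lt_one hX j)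
  obtain ⟨W, hW, h⟩ := (Matrix.toEuclideanLin X).exists_subspace_norm_le j
  refine LinearMap.singularValues_le_of_subspace _ (inv_nonneg.mpr h0.le)
    (W.map (Matrix.toEuclideanLin (X + z • (1 : CMat n)))) ?_ ?_
  · rwa [← LinearEquiv.finrank_eq
      (Submodule.equivMapOfInjective _ (toEuclideanLin_injective_of_isUnit hu) W)]
  · rintro _ ⟨x, hx, rfl⟩
    rw [← LinearMap.comp_apply, ← toEuclideanLin_mul,
      Matrix.nonsing_inv_mul _ ((Matrix.isUnit_iff_isUnit_det _).mp hu), le_inv_mul_iff₀ h0]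
    rw [Matrix.toLpLin_one, LinearMap.id_apply]
    exact one_sub_mul_norm_le hz (h x hx)

/-! ### Inequalities for the Cayley transform -/

theorem prod_one_sub_div_le_prod_singVal_cayley {A : CMat n} (hA : IsStrictContraction A) {k : ℕ}
    {i : Fin k → Fin n} (hi : Function.Injective i) :
    ∏ j : Fin k, (1 - singVal A (i j).rev) / (1 + singVal A j) ≤
      ∏ j : Fin k, singVal (cayley A) (i j) := by
  have hu := isUnit_add_smul_one hA Complex.norm_I
  have hd : 0 < ∏ j : Fin k, (1 + singVal A j) :=
    Finset.prod_pos fun j _ => by linarith [singVal_nonneg A j]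
  rw [Finset.prod_div_distrib, div_le_iff₀ hd, ← Finset.prod_mul_distrib]
  have hc : cayley A * (A + Complex.I • (1 : CMat n)) = A + (-Complex.I) • (1 : CMat n) := by
    rw [cayley, Matrix.nonsing_inv_mul_cancel_right _ _ ((Matrix.isUnit_iff_isUnit_det _).mp hu),
      neg_smul, sub_eq_add_neg]
  calc ∏ j : Fin k, (1 - singVal A (i j).rev)
      ≤ ∏ j : Fin k, singVal (cayley A * (A + Complex.I • (1 : CMat n))) (i j) := by
        rw [hc]
        exact Finset.prod_le_prod (fun j _ => (sub_pos.mpr (singVal_lt_one hA _)).le)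
          fun j _ => one_sub_singVal_rev_le A (by simp) (i j)
    _ ≤ _ := prod_singVal_mul_le' hu hi
    _ ≤ _ := Finset.prod_le_prod
        (fun j _ => mul_nonneg (singVal_nonneg _ _) (singVal_nonneg _ _)) fun j _ =>
          mul_le_mul_of_nonneg_left (singVal_add_smul_one_le A Complex.norm_I j)
            (singVal_nonneg _ _)

theorem prod_singVal_cayley_le {A : CMat n} (hA : IsStrictContraction A) {k : ℕ}
    {i : Fin k → Fin n} (hi : Function.Injective i) :
    ∏ j : Fin k, singVal (cayley A) (i j) ≤
      ∏ j : Fin k, (1 + singVal A (i j)) / (1 - singVal A j) := by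
  have hu := isUnit_add_smul_one hA Complex.norm_I
  refine (prod_singVal_mul_le' ((Matrix.isUnit_nonsing_inv_iff).mpr hu) hi).trans ?_
  refine Finset.prod_le_prod
    (fun j _ => mul_nonneg (singVal_nonneg _ _) (singVal_nonneg _ _)) fun j _ => ?_
  rw [div_eq_mul_inv]
  refine mul_le_mul ?_ (singVal_inv_add_smul_one_le hA Complex.norm_I j) (singVal_nonneg _ _)
    (by linarith [singVal_nonneg A (i j)])
  rw [sub_eq_add_neg, ← neg_smul]
  exact singVal_add_smul_one_le A (by simp) _

/-- Since C(X) = I - 2i(X + iI)⁻¹, this is the resolvent identity Q⁻¹ - P⁻¹ = P⁻¹(P - Q)Q⁻¹. -/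
theorem cayley_sub_cayley {A B : CMat n} (hA : IsUnit (A + Complex.I • (1 : CMat n)))
    (hB : IsUnit (B + Complex.I • (1 : CMat n))) :
    cayley A - cayley B = (A + Complex.I • (1 : CMat n))⁻¹ * ((2 * Complex.I) • (A - B)) *
      (B + Complex.I • (1 : CMat n))⁻¹ := by
  have h : ∀ X : CMat n, IsUnit (X + Complex.I • (1 : CMat n)) →
      cayley X = 1 - (2 * Complex.I) • (X + Complex.I • (1 : CMat n))⁻¹ := by
    intro X hX
    have h1 : X - Complex.I • (1 : CMat n) =
        (X + Complex.I • (1 : CMat n)) - (2 * Complex.I) • (1 : CMat n) := by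
      rw [mul_smul, two_smul]; abel
    rw [cayley, h1, sub_mul, Matrix.mul_nonsing_inv _ ((Matrix.isUnit_iff_isUnit_det _).mp hX),
      Matrix.smul_mul, one_mul]
  have h2 : A - B = (A + Complex.I • (1 : CMat n)) - (B + Complex.I • (1 : CMat n)) := by abel
  rw [h A hA, h B hB, h2]
  generalize A + Complex.I • (1 : CMat n) = P at *
  generalize B + Complex.I • (1 : CMat n) = Q at *
  rw [Matrix.mul_smul, Matrix.smul_mul, mul_sub, sub_mul,
    Matrix.nonsing_inv_mul _ ((Matrix.isUnit_iff_isUnit_det _).mp hA), one_mul, mul_assoc,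
    Matrix.mul_nonsing_inv _ ((Matrix.isUnit_iff_isUnit_det _).mp hB), mul_one, smul_sub]
  abel

theorem prod_singVal_cayley_sub_le {A B : CMat n} (hA : IsStrictContraction A)
    (hB : IsStrictContraction B) {k : ℕ} {i : Fin k → Fin n} (hi : Function.Injective i) :
    ∏ j : Fin k, singVal (cayley A - cayley B) (i j) ≤
      ∏ j : Fin k, (2 * singVal (A - B) (i j)) / ((1 - singVal A j) * (1 - singVal B j)) := by
  have hu := isUnit_add_smul_one hA Complex.norm_I
  have hv := isUnit_add_smul_one hB Complex.norm_I
  rw [cayley_sub_cayley hu hv]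
  refine (prod_singVal_mul_mul_le ((Matrix.isUnit_nonsing_inv_iff).mpr hu)
    ((Matrix.isUnit_nonsing_inv_iff).mpr hv) hi).trans ?_
  refine Finset.prod_le_prod (fun j _ => mul_nonneg (singVal_nonneg _ _)
    (mul_nonneg (singVal_nonneg _ _) (singVal_nonneg _ _))) fun j _ => ?_
  rw [div_eq_mul_inv, mul_inv]
  have h0 : 0 < 1 - singVal A j := sub_pos.mpr (singVal_lt_one hA j)
  refine mul_le_mul ((singVal_smul_le _ _ _).trans_eq (by simp))
    (mul_le_mul (singVal_inv_add_smul_one_le hA Complex.norm_I j)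
      (singVal_inv_add_smul_one_le hB Complex.norm_I j) (singVal_nonneg _ _)
      (inv_nonneg.mpr h0.le))
    (mul_nonneg (singVal_nonneg _ _) (singVal_nonneg _ _))
    (mul_nonneg zero_le_two (singVal_nonneg _ _))

theorem prod_le_prod_singVal_cayley_sub {A B : CMat n} (hA : IsStrictContraction A)
    (hB : IsStrictContraction B) {k : ℕ} {i : Fin k → Fin n} (hi : Function.Injective i) :
    ∏ j : Fin k, (2 * singVal (A - B) (i j)) / ((1 + singVal A j) * (1 + singVal B j)) ≤
      ∏ j : Fin k, singVal (cayley A - cayley B) (i j) := by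
  have hu := isUnit_add_smul_one hA Complex.norm_I
  have hv := isUnit_add_smul_one hB Complex.norm_I
  have hA0 := singVal_nonneg A
  have hB0 := singVal_nonneg B
  have hd : 0 < ∏ j : Fin k, ((1 + singVal A j) * (1 + singVal B j)) :=
    Finset.prod_pos fun j _ => mul_pos (by linarith [hA0 j]) (by linarith [hB0 j])
  rw [Finset.prod_div_distrib, div_le_iff₀ hd, ← Finset.prod_mul_distrib]
  have hc : (2 * Complex.I) • (A - B) = (A + Complex.I • (1 : CMat n)) *
      (cayley A - cayley B) * (B + Complex.I • (1 : CMat n)) := by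
    rw [cayley_sub_cayley hu hv, mul_assoc,
      Matrix.nonsing_inv_mul_cancel_right _ _ ((Matrix.isUnit_iff_isUnit_det _).mp hv),
      Matrix.mul_nonsing_inv_cancel_left _ _ ((Matrix.isUnit_iff_isUnit_det _).mp hu)]
  -- Scaling back by the inverse turns the upper bound `singVal_smul_le` into the lower bound needed
  -- here.
  have hs : A - B = (2 * Complex.I)⁻¹ • (2 * Complex.I) • (A - B) := by
    rw [inv_smul_smul₀ (by simp)]
  calc ∏ j : Fin k, 2 * singVal (A - B) (i j)
      ≤ ∏ j : Fin k, singVal ((2 * Complex.I) • (A - B)) (i j) := by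
        refine Finset.prod_le_prod (fun j _ => mul_nonneg zero_le_two (singVal_nonneg _ _))
          fun j _ => ?_
        have h := singVal_smul_le (2 * Complex.I)⁻¹ ((2 * Complex.I) • (A - B)) (i j)
        rw [← hs] at h
        simp only [norm_inv, norm_mul, Complex.norm_I, RCLike.norm_ofNat, mul_one] at h
        linarith
    _ ≤ ∏ j : Fin k, singVal (cayley A - cayley B) (i j) *
          (singVal (A + Complex.I • (1 : CMat n)) j *
            singVal (B + Complex.I • (1 : CMat n)) j) := by
        rw [hc]
        exact prod_singVal_mul_mul_le hu hv hi
    _ ≤ _ := Finset.prod_le_prod (fun j _ => mul_nonneg (singVal_nonneg _ _)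
          (mul_nonneg (singVal_nonneg _ _) (singVal_nonneg _ _))) fun j _ =>
        mul_le_mul_of_nonneg_left
          (mul_le_mul (singVal_add_smul_one_le A Complex.norm_I j)
            (singVal_add_smul_one_le B Complex.norm_I j) (singVal_nonneg _ _)
            (by linarith [hA0 j]))
          (singVal_nonneg _ _)

end Matrix

theorem theorem4p1 {n : ℕ} (A B : CMat n)
    (hA : IsStrictContraction A) (hB : IsStrictContraction B) :
    -- the Cayley transforms of `A` and `B` are well defined
    (IsUnit (A + Complex.I • (1 : CMat n)) ∧ IsUnit (B + Complex.I • (1 : CMat n))) ∧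
    ∀ (k : ℕ) (i : Fin k → Fin n), StrictMono i →
      -- indices are shifted by one; `(i j).rev` stands for `n - i_j + 1`
      ((∏ j : Fin k, (1 - singVal A (i j).rev) / (1 + singVal A j)
          ≤ ∏ j : Fin k, singVal (cayley A) (i j)) ∧
        (∏ j : Fin k, singVal (cayley A) (i j)
          ≤ ∏ j : Fin k, (1 + singVal A (i j)) / (1 - singVal A j))) ∧
      ((∏ j : Fin k, (2 * singVal (A - B) (i j)) / ((1 + singVal A j) * (1 + singVal B j))
          ≤ ∏ j : Fin k, singVal (cayley A - cayley B) (i j)) ∧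
        (∏ j : Fin k, singVal (cayley A - cayley B) (i j)
          ≤ ∏ j : Fin k,
              (2 * singVal (A - B) (i j)) / ((1 - singVal A j) * (1 - singVal B j)))) := by
  refine ⟨⟨isUnit_add_smul_one hA Complex.norm_I, isUnit_add_smul_one hB Complex.norm_I⟩,
    fun k i hi => ?_⟩
  exact ⟨⟨prod_one_sub_div_le_prod_singVal_cayley hA hi.injective,
      prod_singVal_cayley_le hA hi.injective⟩,
    prod_le_prod_singVal_cayley_sub hA hB hi.injective,
    prod_singVal_cayley_sub_le hA hB hi.injective⟩
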